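/- Graphs are finite and undirected; loops and parallel edges are allowed. A graph is bridgeless if none of its edges is a bridge (it need not be connected), and cubic if every vertex has degree $3$. For an integer $d\ge 0$, an $\mathbb{S}^d$-flow of a graph $G$ is, for some (equivalently, any) orientation of $G$, a map $\varphi$ from the edges of $G$ to the Euclidean unit sphere $\mathbb{S}^d\subset\mathbb{R}^{d+1}$ such that at every vertex $v$ the sum of $\varphi(e)$ over the edges $e$ leaving $v$ equals the sum of $\varphi(e)$ over the edges $e$ entering $v$. An even subgraph of $G$ is a set $C$ of edges such that every vertex has even degree in $C$ (a loop counts twice). Then the following hold. 1. Every bridgeless graph admits an $\mathbb{S}^6$-flow. 2. If the Berge–Fulkerson conjecture holds (every bridgeless cubic graph has six perfect matchings, not necessarily distinct, such that each edge lies in exactly two of them), then every bridgeless cubic graph admits an $\mathbb{S}^5$-flow. 3. If the Celmins–Preissmann conjecture holds (every bridgeless graph has five even subgraphs, not necessarily distinct, such that each edge lies in exactly two of them), then every bridgeless graph admits an $\mathbb{S}^4$-flow. -/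

import Mathlib

universe u v

open scoped Graph

namespace Graph

section Defs

variable {α : Type u} {β : Type v}

/-- A multigraph (loops and parallel edges are allowed) with finitely many vertices and edges. -/
def IsFinite (G : Graph α β) : Prop := V(G).Finite ∧ E(G).Finite

/-- The edge `e` is a bridge: after its removal, its two ends are no longer joined by a walk. -/
def IsBridge (G : Graph α β) (e : β) : Prop :=
  ∃ x y, G.IsLink e x y ∧ ¬ Relation.ReflTransGen (G.deleteEdges {e}).Adj x y

/-- No edge is a bridge (the graph need not be connected). -/
def Bridgeless (G : Graph α β) : Prop := ∀ e ∈ E(G), ¬ G.IsBridge e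

/-- The degree of the vertex `x` in the subgraph with edge set `F`; a loop counts twice. -/
noncomputable def degreeIn (G : Graph α β) (F : Set β) (x : α) : ℕ :=
  (F ∩ G.incidenceSet x).ncard + (F ∩ G.loopSet x).ncard

/-- Every vertex has degree three. -/
def Cubic (G : Graph α β) : Prop := ∀ x ∈ V(G), G.degreeIn E(G) x = 3

/-- `M` is (the edge set of) a perfect matching: each vertex has degree one in `M`. -/
def IsPerfectMatching (G : Graph α β) (M : Set β) : Prop :=
  M ⊆ E(G) ∧ ∀ x ∈ V(G), G.degreeIn M x = 1

/-- `C` is (the edge set of) an even subgraph, also called a cycle in the context of cycle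
double covers: each vertex has even degree in `C`. -/
def IsEvenSubgraph (G : Graph α β) (C : Set β) : Prop :=
  C ⊆ E(G) ∧ ∀ x ∈ V(G), Even (G.degreeIn C x)

/-- An orientation: a choice of an initial and a terminal vertex for each edge. -/
structure Orientation (G : Graph α β) where
  init : E(G) → α
  ter : E(G) → α
  isLink : ∀ e : E(G), G.IsLink e (init e) (ter e)

namespace Orientation

variable {G : Graph α β}

/-- The edges leaving the vertex `x`. -/
def outEdges (D : G.Orientation) (x : α) : Set E(G) := {e | D.init e = x ∧ D.ter e ≠ x}

/-- The edges entering the vertex `x`. -/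
def inEdges (D : G.Orientation) (x : α) : Set E(G) := {e | D.init e ≠ x ∧ D.ter e = x}

/-- Kirchhoff's current law at every vertex. -/
def IsCirculation {A : Type*} [AddCommGroup A] (D : G.Orientation) (φ : E(G) → A) : Prop :=
  ∀ x ∈ V(G), ∑ᶠ e ∈ D.outEdges x, φ e = ∑ᶠ e ∈ D.inEdges x, φ e

/-- A flow is a nowhere-zero circulation. -/
def IsFlow {A : Type*} [AddCommGroup A] (D : G.Orientation) (φ : E(G) → A) : Prop :=
  D.IsCirculation φ ∧ ∀ e, φ e ≠ 0

end Orientation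

/-- `G` admits an `𝕊^d`-flow: for some orientation of `G` there is an `ℝ^(d+1)`-flow all of whose
values lie on the Euclidean unit sphere. -/
def HasSphereFlow (G : Graph α β) (d : ℕ) : Prop :=
  ∃ (D : G.Orientation) (φ : E(G) → EuclideanSpace ℝ (Fin (d + 1))),
    D.IsFlow φ ∧ ∀ e, φ e ∈ Metric.sphere (0 : EuclideanSpace ℝ (Fin (d + 1))) 1

end Defs

/-- The Berge–Fulkerson conjecture: every bridgeless cubic graph has six perfect matchings
(repetitions allowed) such that each edge lies in exactly two of them. -/
def BergeFulkersonConjecture : Prop :=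
  ∀ (α : Type u) (β : Type v) (G : Graph α β), G.IsFinite → G.Bridgeless → G.Cubic →
    ∃ M : Fin 6 → Set β, (∀ i, G.IsPerfectMatching (M i)) ∧
      ∀ e ∈ E(G), {i | e ∈ M i}.ncard = 2

/-- The Celmins–Preissmann conjecture: every bridgeless graph has five even subgraphs
(repetitions allowed) such that each edge lies in exactly two of them. -/
def CelminsPreissmannConjecture : Prop :=
  ∀ (α : Type u) (β : Type v) (G : Graph α β), G.IsFinite → G.Bridgeless →
    ∃ C : Fin 5 → Set β, (∀ i, G.IsEvenSubgraph (C i)) ∧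
      ∀ e ∈ E(G), {i | e ∈ C i}.ncard = 2

end Graph

/-! Suppose `d + 1` even subgraphs cover each edge exactly `k` times. An Eulerian orientation turns
each of them into a circulation with values `±1` on it and `0` elsewhere; these circulations,
divided by `√k`, are the coordinates of an `𝕊^d`-flow (`hasSphereFlow_of_evenSubgraphs`). Five even
subgraphs with `k = 2` give part 3, and the complements of six Berge–Fulkerson matchings, with `k =
4`, give part 2.

For part 1, Jaeger's theorem covers a bridgeless graph by three even subgraphs. Their seven
nontrivial sums over `ZMod 2` contain each edge exactly four times.

Jaeger's theorem is proved by linear algebra: the edge coordinates on the cycle space, without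
repetitions, split into three independent families, and some cycle takes the value 1 on a whole
independent family. The splitting is Horn's theorem, deduced from Rado's; its rank condition is
`card_le_three_mul_finrank_span_cycleCoord`. -/

/-! ### Independent transversals and partitions into independent families -/

section Rado

open Module Submodule

variable {K D ι : Type*} [Field K] [AddCommGroup D] [Module K D] [FiniteDimensional K D]

/-- The induction step in Welsh's proof of Rado's theorem: one of two distinct elements of a member
of the family can be removed without violating Rado's condition. -/
lemma rado_condition_erase [DecidableEq ι] [DecidableEq D] (A : ι → Finset D)
    (hA : ∀ I : Finset ι, I.card ≤ finrank K (span K (⋃ i ∈ I, (A i : Set D))))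
    (i : ι) {x y : D} (hxy : x ≠ y) (hx : x ∈ A i) :
    (∀ I : Finset ι, I.card ≤ finrank K
      (span K (⋃ j ∈ I, (Function.update A i ((A i).erase x) j : Set D)))) ∨
    (∀ I : Finset ι, I.card ≤ finrank K
      (span K (⋃ j ∈ I, (Function.update A i ((A i).erase y) j : Set D)))) := by
  -- A violation must involve `i`; dropping `i` from the index set leaves a set `J` whose members,
  -- together with the reduced set, have rank at most `J.card`.
  have key : ∀ z (I : Finset ι), ¬ I.card ≤ finrank K
      (span K (⋃ j ∈ I, (Function.update A i ((A i).erase z) j : Set D))) →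
      ∃ J : Finset ι, i ∉ J ∧ finrank K
        (span K ((⋃ j ∈ J, (A j : Set D)) ∪ ((A i).erase z : Finset D)) : Submodule K D)
          ≤ J.card := by
    intro z I hI
    have hi : i ∈ I := by
      by_contra hi
      apply hI
      have : (⋃ j ∈ I, (Function.update A i ((A i).erase z) j : Set D)) =
          ⋃ j ∈ I, (A j : Set D) := by
        refine Set.iUnion₂_congr fun j hj ↦ ?_
        rw [Function.update_of_ne (by rintro rfl; exact hi hj)]
      rw [this]
      exact hA I
    refine ⟨I.erase i, by simp, ?_⟩
    have hc := Finset.card_erase_add_one hi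
    have : (⋃ j ∈ I, (Function.update A i ((A i).erase z) j : Set D)) =
        (⋃ j ∈ I.erase i, (A j : Set D)) ∪ ((A i).erase z : Finset D) := by
      conv_lhs => rw [← Finset.insert_erase hi]
      rw [Finset.set_biUnion_insert, Function.update_self, Set.union_comm]
      congr 1
      refine Set.iUnion₂_congr fun j hj ↦ ?_
      rw [Function.update_of_ne (Finset.ne_of_mem_erase hj)]
    rw [this] at hI
    omega
  by_contra! h
  obtain ⟨⟨I, hI⟩, ⟨J, hJ⟩⟩ := h
  obtain ⟨I', hiI, hI'⟩ := key x I (by omega)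
  obtain ⟨J', hiJ, hJ'⟩ := key y J (by omega)
  set S := (span K ((⋃ j ∈ I', (A j : Set D)) ∪ ((A i).erase x : Finset D)) : Submodule K D)
  set T := (span K ((⋃ j ∈ J', (A j : Set D)) ∪ ((A i).erase y : Finset D)) : Submodule K D)
  -- Since `x ≠ y`, the two reduced sets together recover `A i`, which gains 1 in the union bound.
  -- With `h2` and the dimension formula this contradicts `hI'` and `hJ'`.
  have h1 : (insert i (I' ∪ J')).card ≤ finrank K (S ⊔ T : Submodule K D) := by
    refine (hA _).trans (finrank_mono ?_)
    rw [← span_union]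
    apply span_mono
    intro z hz
    simp only [Set.mem_iUnion, Finset.mem_insert, Finset.mem_union] at hz
    obtain ⟨j, hj, hz⟩ := hz
    rcases hj with rfl | hj | hj
    · by_cases hzx : z = x
      · right; right; subst hzx; simpa [hxy] using hx
      · left; right; simpa [hzx] using hz
    · left; left; simp only [Set.mem_iUnion]; exact ⟨j, hj, hz⟩
    · right; left; simp only [Set.mem_iUnion]; exact ⟨j, hj, hz⟩
  have h2 : (I' ∩ J').card ≤ finrank K (S ⊓ T : Submodule K D) := by
    refine (hA _).trans (finrank_mono (le_inf ?_ ?_)) <;>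
    · apply span_mono
      refine Set.Subset.trans ?_ Set.subset_union_left
      refine Set.biUnion_subset_biUnion_left fun j hj ↦ ?_
      have hj := Finset.mem_inter.1 hj
      first | exact hj.1 | exact hj.2
  have h3 := Submodule.finrank_sup_add_finrank_inf_eq S T
  have h4 := Finset.card_union_add_card_inter I' J'
  rw [Finset.card_insert_of_notMem (by simp [hiI, hiJ])] at h1
  omega

/-- **Rado's theorem** for vector spaces: a finite family of finite sets of vectors has a linearly
independent transversal if any `k` of the sets span a space of dimension at least `k`. -/
theorem exists_linearIndependent_transversal [Fintype ι] (A : ι → Finset D)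
    (hA : ∀ I : Finset ι, I.card ≤ finrank K (span K (⋃ i ∈ I, (A i : Set D)))) :
    ∃ x : ι → D, (∀ i, x i ∈ A i) ∧ LinearIndependent K x := by
  classical
  induction hn : ∑ i, (A i).card using Nat.strong_induction_on generalizing A with
  | _ n ih =>
  subst hn
  by_cases h : ∀ i, (A i).card ≤ 1
  · have hne : ∀ i, ∃ x, A i = {x} := by
      intro i
      rw [← Finset.card_eq_one]
      refine le_antisymm (h i) ?_
      have := hA {i}
      rw [Finset.card_singleton, Finset.set_biUnion_singleton] at this
      exact this.trans (finrank_span_finset_le_card (A i))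
    choose x hx using hne
    refine ⟨x, fun i ↦ by simp [hx], ?_⟩
    rw [linearIndependent_iff_card_le_finrank_span]
    have := hA Finset.univ
    have hr : (⋃ i ∈ Finset.univ, (A i : Set D)) = Set.range x := by ext; simp [hx, eq_comm]
    rwa [hr] at this
  · push Not at h
    obtain ⟨i, hi⟩ := h
    obtain ⟨x, hx, y, hy, hxy⟩ := Finset.one_lt_card.1 hi
    have step : ∀ z ∈ A i, (∀ I : Finset ι, I.card ≤ finrank K
        (span K (⋃ j ∈ I, (Function.update A i ((A i).erase z) j : Set D)))) →
        ∃ x : ι → D, (∀ i, x i ∈ A i) ∧ LinearIndependent K x := by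
      intro z hz hB
      have hle : ∀ j, Function.update A i ((A i).erase z) j ⊆ A j := by
        intro j
        by_cases hj : j = i
        · subst hj; simpa using Finset.erase_subset _ _
        · simp [hj]
      obtain ⟨w, hw, hw'⟩ := ih _ (Finset.sum_lt_sum (fun j _ ↦ Finset.card_le_card (hle j))
        ⟨i, Finset.mem_univ _, by simpa using Finset.card_erase_lt_of_mem hz⟩) _ hB rfl
      exact ⟨w, fun j ↦ hle j (hw j), hw'⟩
    rcases rado_condition_erase A hA i hxy hx with hB | hB
    · exact step x hx hB
    · exact step y hy hB

/-- **Horn's theorem**: a finite family of vectors can be partitioned into `k` linearly independent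
families if every subfamily has at most `k` times as many members as its dimension. -/
theorem exists_coloring_linearIndependent [Fintype ι] (k : ℕ) (w : ι → D)
    (hw : ∀ I : Finset ι, I.card ≤ k * finrank K (span K (w '' I))) :
    ∃ c : ι → Fin k, ∀ j, LinearIndependent K (fun i : {i // c i = j} ↦ w i) := by
  classical
  -- Each `w i` is offered in each of the `k` summands of `D^k`; the summand chosen by the
  -- transversal is the colour of `i`.
  obtain ⟨x, hx, hli⟩ := exists_linearIndependent_transversal (K := K)
    (fun i ↦ Finset.univ.image fun j : Fin k ↦ (Pi.single j (w i) : Fin k → D)) (by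
      intro I
      refine (hw I).trans ?_
      set p := span K (w '' I)
      have h1 : k * finrank K p = finrank K (Fin k → p) := by simp [finrank_pi_fintype]
      rw [h1, ← LinearMap.finrank_range_of_inj
        (f := LinearMap.pi fun j ↦ p.subtype.comp (LinearMap.proj (R := K) (φ := fun _ ↦ p) j))
        (fun f g hfg ↦ by ext j; exact congrFun hfg j)]
      apply finrank_mono
      rintro _ ⟨f, rfl⟩
      rw [← Finset.univ_sum_single (LinearMap.pi _ f)]
      refine Submodule.sum_mem _ fun j _ ↦ ?_
      have h2 : LinearMap.single K (fun _ : Fin k ↦ D) j (f j) ∈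
          p.map (LinearMap.single K (fun _ : Fin k ↦ D) j) := mem_map_of_mem (f j).2
      rw [map_span] at h2
      refine span_mono ?_ h2
      rintro _ ⟨_, ⟨i, hi, rfl⟩, rfl⟩
      simp only [Set.mem_iUnion]
      exact ⟨i, hi, by simp⟩)
  simp only [Finset.mem_image, Finset.mem_univ, true_and] at hx
  choose c hc using hx
  refine ⟨c, fun j ↦ LinearIndependent.of_comp (LinearMap.single K (fun _ : Fin k ↦ D) j) ?_⟩
  have hcomp : (LinearMap.single K (fun _ : Fin k ↦ D) j) ∘ (fun i : {i // c i = j} ↦ w i) =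
      x ∘ fun i : {i // c i = j} ↦ (i : ι) := by
    ext1 ⟨i, hi⟩
    subst hi
    simp [hc]
  rw [hcomp]
  exact hli.comp _ Subtype.val_injective

/-- If every subfamily of a finite family of linear functionals has at most `k` times as many
members as its dimension, then there are `k` vectors such that each functional is nonzero on at
least one of them. -/
theorem exists_vectors_forall_exists_apply_ne_zero [Fintype ι] (k : ℕ) (w : ι → Dual K D)
    (hw : ∀ I : Finset ι, I.card ≤ k * finrank K (span K (w '' I))) :
    ∃ z : Fin k → D, ∀ i, ∃ j, w i (z j) ≠ 0 := by
  obtain ⟨c, hc⟩ := exists_coloring_linearIndependent k w hw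
  have : ∀ j, ∃ z : D, ∀ i, c i = j → w i z = 1 := by
    intro j
    -- By reflexivity, a functional on the dual that is 1 on a basis containing the colour class is
    -- evaluation at a vector.
    let b := Basis.extend (hc j).linearIndepOn_id
    let φ : Dual K (Dual K D) := b.constr K fun _ ↦ 1
    refine ⟨(evalEquiv K D).symm φ, fun i hi ↦ ?_⟩
    rw [apply_evalEquiv_symm_apply]
    have hmem : w i ∈ (hc j).linearIndepOn_id.extend (Set.subset_univ _) :=
      (hc j).linearIndepOn_id.subset_extend _ ⟨⟨i, hi⟩, rfl⟩
    have : w i = b ⟨w i, hmem⟩ := by simp [b]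
    rw [this, b.constr_basis]
  choose z hz using this
  exact ⟨z, fun i ↦ ⟨c i, by simp [hz (c i) i rfl]⟩⟩

end Rado

/-! ### The binary cycle space and Jaeger's theorem -/

section CycleSpace

open Module Submodule

variable {V E : Type*} [Fintype E]

/-- The boundary map over `ZMod 2` of the multigraph in which the edge `e` joins `s e` and `t e`. -/
noncomputable def boundaryMap (s t : E → V) : (E → ZMod 2) →ₗ[ZMod 2] (V →₀ ZMod 2) :=
  Fintype.linearCombination (ZMod 2) fun e ↦ Finsupp.single (s e) 1 + Finsupp.single (t e) 1

/-- The coordinate of the edge `e` as a functional on the cycle space. -/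
noncomputable def cycleCoord (s t : E → V) (e : E) :
    Dual (ZMod 2) (LinearMap.ker (boundaryMap s t)) :=
  (LinearMap.proj e).comp (Submodule.subtype _)

@[simp]
lemma cycleCoord_apply (s t : E → V) (e : E) (z : LinearMap.ker (boundaryMap s t)) :
    cycleCoord s t e z = z.1 e := rfl

lemma boundaryMap_apply (s t : E → V) (z : E → ZMod 2) :
    boundaryMap s t z = ∑ e, z e • (Finsupp.single (s e) 1 + Finsupp.single (t e) 1) := rfl

/-- Pairing the boundary of `z` with a vertex labelling. -/
lemma linearCombination_boundaryMap (s t : E → V) (p : V → ZMod 2) (z : E → ZMod 2) :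
    Finsupp.linearCombination (ZMod 2) p (boundaryMap s t z) = ∑ e, z e * (p (s e) + p (t e)) := by
  simp [boundaryMap_apply, mul_add]

/-- A linear relation between coordinates on the cycle space is a cut. -/
lemma exists_labelling_of_forall_cycle (s t : E → V) (c : E → ZMod 2)
    (hc : ∀ z ∈ LinearMap.ker (boundaryMap s t), ∑ e, c e * z e = 0) :
    ∃ p : V → ZMod 2, ∀ e, c e = p (s e) + p (t e) := by
  classical
  have h : Fintype.linearCombination (ZMod 2) c ∈
      (LinearMap.ker (boundaryMap s t)).dualAnnihilator := by
    rw [mem_dualAnnihilator]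
    intro z hz
    simpa [Fintype.linearCombination_apply, mul_comm] using hc z hz
  rw [← LinearMap.range_dualMap_eq_dualAnnihilator_ker] at h
  obtain ⟨φ, hφ⟩ := h
  refine ⟨fun v ↦ φ (Finsupp.single v 1), fun e ↦ ?_⟩
  have := LinearMap.congr_fun hφ (Pi.single e 1)
  simp only [LinearMap.dualMap_apply, boundaryMap, Fintype.linearCombination_apply_single,
    map_add, one_smul] at this
  exact this.symm

lemma ZMod.eq_one_of_ne_zero_two {a : ZMod 2} (h : a ≠ 0) : a = 1 := by
  revert a; decide

/-- Distinct nonzero coordinates on the cycle space span a space of dimension at least a third of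
their number: the relations between them are generated by cuts of size at least three around
vertices of a contraction of the graph. -/
lemma card_le_three_mul_finrank_span_cycleCoord (s t : E → V) (X : Finset E)
    (h1 : ∀ e ∈ X, cycleCoord s t e ≠ 0) (h2 : Set.InjOn (cycleCoord s t) X) :
    X.card ≤ 3 * finrank (ZMod 2) (span (ZMod 2) (cycleCoord s t '' X)) := by
  classical
  let L : (X → ZMod 2) →ₗ[ZMod 2] Dual (ZMod 2) (LinearMap.ker (boundaryMap s t)) :=
    Fintype.linearCombination (ZMod 2) fun e : X ↦ cycleCoord s t e
  have hL : ∀ c z, L c z = ∑ e : X, c e * z.1 e := by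
    intro c z
    simp [L, Fintype.linearCombination_apply]
  have hrange : LinearMap.range L = span (ZMod 2) (cycleCoord s t '' X) := by
    rw [Fintype.range_linearCombination]
    congr 1
    ext; simp
  have hrn := L.finrank_range_add_finrank_ker
  rw [hrange, finrank_fintype_fun_eq_card, Fintype.card_coe] at hrn
  -- Contract all edges outside `X`; `δ k` is then the star of the contracted vertex `k`, in which
  -- loops cancel modulo 2. As `V` may be infinite, `𝒦` keeps only ends of edges of `X`.
  let q : V → Quot (fun a b ↦ ∃ e ∉ X, s e = a ∧ t e = b) := Quot.mk _
  have hq : ∀ e ∉ X, q (s e) = q (t e) := fun e he ↦ Quot.sound ⟨e, he, rfl, rfl⟩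
  let δ : Quot (fun a b ↦ ∃ e ∉ X, s e = a ∧ t e = b) → X → ZMod 2 :=
    fun k e ↦ (if q (s e) = k then 1 else 0) + (if q (t e) = k then 1 else 0)
  let 𝒦 := (X.image (fun e ↦ q (s e)) ∪ X.image fun e ↦ q (t e)).filter fun k ↦ δ k ≠ 0
  have hδ : ∀ k, L (δ k) = 0 := by
    intro k
    ext z
    rw [hL, LinearMap.zero_apply]
    have hz := linearCombination_boundaryMap s t (fun v ↦ if q v = k then 1 else 0) z.1
    rw [LinearMap.mem_ker.1 z.2, map_zero, ← Finset.sum_subset (Finset.subset_univ X)] at hz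
    · rw [hz, ← Finset.sum_coe_sort X]
      exact Finset.sum_congr rfl fun e _ ↦ mul_comm _ _
    · intro e _ he
      rw [hq e he, CharTwo.add_self_eq_zero, mul_zero]
  -- A relation extended by 0 off `X` is a cut whose labelling descends to the contraction, hence a
  -- sum of stars.
  have hker : LinearMap.ker L ≤ span (ZMod 2) (𝒦.image δ : Finset (X → ZMod 2)) := by
    intro c hc
    obtain ⟨p, hp⟩ := exists_labelling_of_forall_cycle s t
      (fun e ↦ if h : e ∈ X then c ⟨e, h⟩ else 0) (by
        intro z hz
        have := hL c ⟨z, hz⟩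
        rw [LinearMap.mem_ker.1 hc, LinearMap.zero_apply] at this
        refine Eq.trans ?_ this.symm
        rw [← Finset.sum_subset (Finset.subset_univ X)]
        · rw [← Finset.sum_coe_sort X]
          exact Finset.sum_congr rfl fun e _ ↦ by simp
        · intro e _ he
          simp [he])
    let p' : Quot (fun a b ↦ ∃ e ∉ X, s e = a ∧ t e = b) → ZMod 2 := Quot.lift p (by
      rintro _ _ ⟨e, he, rfl, rfl⟩
      have := hp e
      rw [dif_neg he] at this
      exact CharTwo.add_eq_zero.1 this.symm)
    have hc' : c = ∑ k ∈ X.image (fun e ↦ q (s e)) ∪ X.image (fun e ↦ q (t e)), p' k • δ k := by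
      ext e
      have he := hp e
      rw [dif_pos e.2] at he
      have hs : q (s e) ∈ X.image (fun e ↦ q (s e)) ∪ X.image (fun e ↦ q (t e)) :=
        Finset.mem_union_left _ (Finset.mem_image_of_mem (fun e ↦ q (s e)) e.2)
      have ht : q (t e) ∈ X.image (fun e ↦ q (s e)) ∪ X.image (fun e ↦ q (t e)) :=
        Finset.mem_union_right _ (Finset.mem_image_of_mem (fun e ↦ q (t e)) e.2)
      rw [he, Finset.sum_apply]
      simp only [δ, Pi.smul_apply, smul_eq_mul, mul_add, Finset.sum_add_distrib, mul_ite, mul_one,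
        mul_zero, Finset.sum_ite_eq, if_pos hs, if_pos ht]
      rfl
    rw [hc']
    refine Submodule.sum_mem _ fun k hk ↦ smul_mem _ _ ?_
    by_cases h0 : δ k = 0
    · rw [h0]; exact zero_mem _
    · exact subset_span (Finset.mem_coe.2 (Finset.mem_image_of_mem _ (Finset.mem_filter.2 ⟨hk, h0⟩)))
  have hW : finrank (ZMod 2) (LinearMap.ker L) ≤ 𝒦.card :=
    (finrank_mono hker).trans ((finrank_span_finset_le_card _).trans Finset.card_image_le)
  -- A star of one edge would make a coordinate zero; a star of two edges would make two coordinates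
  -- equal.
  have hsupp : ∀ k ∈ 𝒦, 3 ≤ (Finset.univ.filter fun e ↦ δ k e ≠ 0).card := by
    intro k hk
    by_contra! hlt
    have hsum : ∀ z : LinearMap.ker (boundaryMap s t),
        ∑ e ∈ Finset.univ.filter (fun e ↦ δ k e ≠ 0), z.1 e = 0 := by
      intro z
      have := hL (δ k) z
      rw [hδ, LinearMap.zero_apply] at this
      refine Eq.trans ?_ this.symm
      rw [Finset.sum_filter]
      refine Finset.sum_congr rfl fun e _ ↦ ?_
      split_ifs with h
      · rw [ZMod.eq_one_of_ne_zero_two h, one_mul]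
      · rw [not_not.1 h, zero_mul]
    have hcases : (Finset.univ.filter fun e ↦ δ k e ≠ 0).card = 0 ∨
      (Finset.univ.filter fun e ↦ δ k e ≠ 0).card = 1 ∨
      (Finset.univ.filter fun e ↦ δ k e ≠ 0).card = 2 := by omega
    rcases hcases with h | h | h
    · rw [Finset.card_eq_zero, Finset.filter_eq_empty_iff] at h
      exact (Finset.mem_filter.1 hk).2 (funext fun e ↦ not_not.1 (h (Finset.mem_univ e)))
    · obtain ⟨e, he⟩ := Finset.card_eq_one.1 h
      rw [he] at hsum
      exact h1 e e.2 (LinearMap.ext fun z ↦ by simpa using hsum z)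
    · obtain ⟨e, f, hef, he⟩ := Finset.card_eq_two.1 h
      rw [he] at hsum
      refine hef (Subtype.ext (h2 e.2 f.2 (LinearMap.ext fun z ↦ ?_)))
      have := hsum z
      rw [Finset.sum_pair hef] at this
      exact CharTwo.add_eq_zero.1 this
  -- Double counting: an edge lies only in the stars of its two ends. So the relations have
  -- dimension at most two thirds of `X.card`.
  have hcount : 3 * 𝒦.card ≤ 2 * X.card := by
    calc 3 * 𝒦.card = ∑ k ∈ 𝒦, 3 := by rw [Finset.sum_const, smul_eq_mul, mul_comm]
      _ ≤ ∑ k ∈ 𝒦, (Finset.univ.filter fun e ↦ δ k e ≠ 0).card := Finset.sum_le_sum hsupp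
      _ = ∑ e : X, (𝒦.filter fun k ↦ δ k e ≠ 0).card :=
        Finset.sum_card_bipartiteAbove_eq_sum_card_bipartiteBelow (fun k e ↦ δ k e ≠ 0)
      _ ≤ ∑ e : X, 2 := by
        refine Finset.sum_le_sum fun e _ ↦ (Finset.card_le_card (t := {q (s e), q (t e)}) ?_).trans
          Finset.card_le_two
        intro k hk
        by_contra hne
        simp only [Finset.mem_insert, Finset.mem_singleton, not_or] at hne
        refine (Finset.mem_filter.1 hk).2 ?_
        simp [δ, Ne.symm hne.1, Ne.symm hne.2]
      _ = 2 * X.card := by simp [mul_comm]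
  omega

/-- **Jaeger's theorem**: if each edge of a finite multigraph lies in an even subgraph, then all
edges can be covered by three even subgraphs. -/
theorem exists_three_cycles_cover (s t : E → V)
    (h : ∀ e, ∃ z : E → ZMod 2, boundaryMap s t z = 0 ∧ z e ≠ 0) :
    ∃ z : Fin 3 → E → ZMod 2, (∀ j, boundaryMap s t (z j) = 0) ∧ ∀ e, ∃ j, z j e ≠ 0 := by
  classical
  -- The index set is the set of coordinates, not of edges, because distinct edges may have equal
  -- coordinates.
  obtain ⟨z, hz⟩ := exists_vectors_forall_exists_apply_ne_zero 3
    (fun w : Finset.univ.image (cycleCoord s t) ↦ w.1) (by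
      intro I
      have hinv : ∀ w : Finset.univ.image (cycleCoord s t), ∃ e, cycleCoord s t e = w.1 := by
        intro w
        obtain ⟨e, -, he⟩ := Finset.mem_image.1 w.2
        exact ⟨e, he⟩
      choose r hr using hinv
      have hrinj : Function.Injective r := fun a b hab ↦ Subtype.ext (by rw [← hr, ← hr, hab])
      have := card_le_three_mul_finrank_span_cycleCoord s t (I.image r) (by
        intro e _ h0
        obtain ⟨z, hz, hze⟩ := h e
        exact hze (LinearMap.congr_fun h0 ⟨z, hz⟩)) (by
        intro a ha b hb hab
        simp only [Finset.coe_image, Set.mem_image] at ha hb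
        obtain ⟨a, -, rfl⟩ := ha
        obtain ⟨b, -, rfl⟩ := hb
        rw [hr, hr] at hab
        rw [Subtype.ext hab])
      rw [Finset.card_image_of_injective _ hrinj, Finset.coe_image, ← Set.image_comp] at this
      have hfun : cycleCoord s t ∘ r = fun w ↦ w.1 := funext hr
      rwa [hfun] at this)
  exact ⟨fun j ↦ (z j).1, fun j ↦ (z j).2, fun e ↦
    hz ⟨cycleCoord s t e, Finset.mem_image_of_mem _ (Finset.mem_univ e)⟩⟩

end CycleSpace

/-! ### Eulerian orientations by splitting off -/

section Eulerian

variable {V E : Type*}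

/-- **Eulerian orientations**: if every vertex is met evenly often by the edges `e ∈ C`, joining
`s e` and `t e`, then signs can be chosen such that the signed sum of the edges is balanced. -/
theorem exists_signs_balanced [DecidableEq V] (C : Finset E) (s t : E → V)
    (h : ∀ x, Even (∑ e ∈ C, ((if s e = x then 1 else 0) + (if t e = x then 1 else 0) : ℤ))) :
    ∃ f : E → ℤ, (∀ e, f e = 1 ∨ f e = -1) ∧
      ∀ x, ∑ e ∈ C, f e * ((if s e = x then 1 else 0) - (if t e = x then 1 else 0)) = 0 := by
  classical
  induction hn : C.card generalizing C s t with
  | zero =>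
    rw [Finset.card_eq_zero] at hn
    subst hn
    exact ⟨fun _ ↦ 1, by simp, by simp⟩
  | succ n ih =>
    by_cases hloop : ∀ e ∈ C, s e = t e
    · refine ⟨fun _ ↦ 1, by simp, fun x ↦ Finset.sum_eq_zero fun e he ↦ ?_⟩
      rw [hloop e he, sub_self, mul_zero]
    push Not at hloop
    obtain ⟨e, he, hst⟩ := hloop
    -- By parity, a second non-loop edge meets `t e`.
    obtain ⟨g, hg, hodd⟩ : ∃ g ∈ C.erase e,
        ¬ Even ((if s g = t e then 1 else 0) + (if t g = t e then 1 else 0) : ℤ) := by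
      by_contra! hcon
      have h1 := h (t e)
      have h2 : Even (∑ g ∈ C.erase e,
          ((if s g = t e then 1 else 0) + (if t g = t e then 1 else 0) : ℤ)) :=
        Finset.sum_induction _ Even (fun _ _ ↦ Even.add) Even.zero hcon
      rw [← Finset.add_sum_erase C _ he, Int.even_add] at h1
      simp [hst, h2] at h1
    have hge := Finset.ne_of_mem_erase hg
    have hcard : (C.erase e).card = n := by rw [Finset.card_erase_of_mem he, hn]; rfl
    -- split off the edges `e` and `g` at the vertex `t e`
    have split : ∀ F : E → ℤ, ∑ a ∈ C, F a = F e + (F g + ∑ a ∈ (C.erase e).erase g, F a) := by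
      intro F
      rw [← Finset.add_sum_erase C _ he, ← Finset.add_sum_erase _ _ hg]
    have rest : ∀ (F : E → V → V → ℤ) (s' t' : E → V), (∀ a ≠ g, s' a = s a) →
        (∀ a ≠ g, t' a = t a) → ∑ a ∈ C.erase e, F a (s' a) (t' a) =
          F g (s' g) (t' g) + ∑ a ∈ (C.erase e).erase g, F a (s a) (t a) := by
      intro F s' t' hs' ht'
      rw [← Finset.add_sum_erase _ _ hg]
      congr 1
      refine Finset.sum_congr rfl fun a ha ↦ ?_
      rw [hs' a (Finset.ne_of_mem_erase ha), ht' a (Finset.ne_of_mem_erase ha)]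
    by_cases hsg : s g = t e
    · have hs' : ∀ a ≠ g, Function.update s g (s e) a = s a := fun a ha ↦ by simp [ha]
      obtain ⟨f, hf, hbal⟩ := ih (C.erase e) (Function.update s g (s e)) t (by
        intro x
        have hx := h x
        rw [split] at hx
        rw [rest (fun _ a b ↦ (if a = x then 1 else 0) + (if b = x then 1 else 0)) _ t hs'
          (fun _ _ ↦ rfl), Function.update_self]
        rw [hsg] at hx
        rw [Int.even_iff] at hx ⊢
        omega) hcard
      -- The merged edge runs along `e` and then along `g`, so both get the same sign.
      refine ⟨Function.update f e (f g), fun a ↦ ?_, fun x ↦ ?_⟩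
      · by_cases ha : a = e
        · subst ha; simpa using hf g
        · simpa [ha] using hf a
      · have hx := hbal x
        rw [rest (fun c a b ↦ f c * ((if a = x then 1 else 0) - (if b = x then 1 else 0))) _ t hs'
          (fun _ _ ↦ rfl), Function.update_self] at hx
        rw [split, Function.update_self, Function.update_of_ne hge, hsg]
        have hsum : ∑ a ∈ (C.erase e).erase g, Function.update f e (f g) a *
              ((if s a = x then 1 else 0) - (if t a = x then 1 else 0)) =
            ∑ a ∈ (C.erase e).erase g,
              f a * ((if s a = x then 1 else 0) - (if t a = x then 1 else 0)) :=
          Finset.sum_congr rfl fun a ha ↦ by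
            rw [Function.update_of_ne (Finset.ne_of_mem_erase (Finset.mem_of_mem_erase ha))]
        rw [hsum]
        linear_combination hx
    · have htg : t g = t e := by
        by_contra htg
        simp [hsg, htg] at hodd
      have ht' : ∀ a ≠ g, Function.update t g (s e) a = t a := fun a ha ↦ by simp [ha]
      obtain ⟨f, hf, hbal⟩ := ih (C.erase e) s (Function.update t g (s e)) (by
        intro x
        have hx := h x
        rw [split] at hx
        rw [rest (fun _ a b ↦ (if a = x then 1 else 0) + (if b = x then 1 else 0)) s _
          (fun _ _ ↦ rfl) ht', Function.update_self]
        rw [htg] at hx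
        rw [Int.even_iff] at hx ⊢
        omega) hcard
      -- Here the merged edge runs along `g` and then backwards along `e`, hence the opposite sign.
      refine ⟨Function.update f e (-f g), fun a ↦ ?_, fun x ↦ ?_⟩
      · by_cases ha : a = e
        · subst ha
          rw [Function.update_self]
          have := hf g
          omega
        · simpa [ha] using hf a
      · have hx := hbal x
        rw [rest (fun c a b ↦ f c * ((if a = x then 1 else 0) - (if b = x then 1 else 0))) s _
          (fun _ _ ↦ rfl) ht', Function.update_self] at hx
        rw [split, Function.update_self, Function.update_of_ne hge, htg]
        have hsum : ∑ a ∈ (C.erase e).erase g, Function.update f e (-f g) a *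
              ((if s a = x then 1 else 0) - (if t a = x then 1 else 0)) =
            ∑ a ∈ (C.erase e).erase g,
              f a * ((if s a = x then 1 else 0) - (if t a = x then 1 else 0)) :=
          Finset.sum_congr rfl fun a ha ↦ by
            rw [Function.update_of_ne (Finset.ne_of_mem_erase (Finset.mem_of_mem_erase ha))]
        rw [hsum]
        linear_combination hx

end Eulerian

/-! ### From even subgraphs to sphere flows -/

namespace Graph

variable {α : Type u} {β : Type v} {G : Graph α β}

lemma nonempty_orientation (G : Graph α β) : Nonempty G.Orientation := by
  have h : ∀ e : E(G), ∃ x y, G.IsLink e x y := fun e ↦ exists_isLink_of_mem_edgeSet e.2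
  choose s t hst using h
  exact ⟨⟨s, t, hst⟩⟩

/-- The degree as a sum over the edges with respect to an orientation. -/
lemma Orientation.degreeIn_eq_sum (D : G.Orientation) [Fintype E(G)] [DecidableEq α] (F : Set β)
    [DecidablePred (· ∈ F)] (x : α) :
    G.degreeIn F x = ∑ e ∈ Finset.univ.filter (fun e : E(G) ↦ (e : β) ∈ F),
      ((if D.init e = x then 1 else 0) + (if D.ter e = x then 1 else 0)) := by
  classical
  have key : ∀ S : Set β, S ⊆ E(G) → (F ∩ S).ncard =
      ((Finset.univ.filter fun e : E(G) ↦ (e : β) ∈ F).filter fun e : E(G) ↦ (e : β) ∈ S).card := by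
    intro S hS
    rw [← Set.ncard_coe_finset]
    refine Eq.trans ?_ (Set.ncard_image_of_injective _ Subtype.val_injective)
    congr 1
    ext b
    simp only [Set.mem_inter_iff, Finset.coe_filter, Finset.mem_filter, Finset.mem_univ, true_and,
      Set.mem_image, Set.mem_ofPred_eq, Subtype.exists, exists_and_right, exists_eq_right]
    exact ⟨fun h ↦ ⟨⟨hS h.2, h.1⟩, h.2⟩, fun ⟨⟨_, h1⟩, h2⟩ ↦ ⟨h1, h2⟩⟩
  rw [degreeIn, key _ (G.incidenceSet_subset_edgeSet x),
    key _ ((G.loopSet_subset_incidenceSet x).trans (G.incidenceSet_subset_edgeSet x)),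
    Finset.card_filter, Finset.card_filter, ← Finset.sum_add_distrib]
  refine Finset.sum_congr rfl fun e _ ↦ ?_
  have hl := D.isLink e
  have hinc : (e : β) ∈ G.incidenceSet x ↔ D.init e = x ∨ D.ter e = x := by
    rw [mem_incidenceSet]
    constructor
    · intro h
      rcases h.eq_or_eq_of_isLink hl with h | h
      · exact .inl h.symm
      · exact .inr h.symm
    · rintro (rfl | rfl)
      · exact hl.inc_left
      · exact hl.inc_right
  have hloop : (e : β) ∈ G.loopSet x ↔ D.init e = x ∧ D.ter e = x := by
    rw [mem_loopSet, IsLoopAt, hl.isLink_iff]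
    tauto
  simp only [hinc, hloop]
  by_cases h1 : D.init e = x <;> by_cases h2 : D.ter e = x <;> simp [h1, h2]

/-- Kirchhoff's law in terms of signed incidences. -/
lemma Orientation.isCirculation_of_sum_eq_zero (D : G.Orientation) [Fintype E(G)] [DecidableEq α]
    {A : Type*} [AddCommGroup A] (φ : E(G) → A)
    (h : ∀ x, ∑ e, ((if D.init e = x then 1 else 0) - (if D.ter e = x then 1 else 0) : ℤ) • φ e
      = 0) : D.IsCirculation φ := by
  classical
  intro x _
  rw [finsum_mem_eq_finite_toFinset_sum _ (Set.toFinite _),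
    finsum_mem_eq_finite_toFinset_sum _ (Set.toFinite _), ← sub_eq_zero, ← h x]
  have : ∀ S : Set E(G), ∑ e ∈ (Set.toFinite S).toFinset, φ e = ∑ e, if e ∈ S then φ e else 0 := by
    intro S
    rw [← Finset.sum_filter]
    refine Finset.sum_congr ?_ fun _ _ ↦ rfl
    ext; simp
  rw [this, this, ← Finset.sum_sub_distrib]
  refine Finset.sum_congr rfl fun e _ ↦ ?_
  simp only [outEdges, inEdges, Set.mem_ofPred_eq]
  by_cases h1 : D.init e = x <;> by_cases h2 : D.ter e = x <;> simp [h1, h2]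

/-- An even subgraph carries a circulation with values `±1`. -/
lemma IsEvenSubgraph.exists_circulation [Fintype E(G)] [DecidableEq α] {C : Set β}
    [DecidablePred (· ∈ C)] (hC : G.IsEvenSubgraph C) (D : G.Orientation) :
    ∃ f : E(G) → ℤ, (∀ e, f e ^ 2 = if (e : β) ∈ C then 1 else 0) ∧
      ∀ x, ∑ e, f e * ((if D.init e = x then 1 else 0) - (if D.ter e = x then 1 else 0)) = 0 := by
  obtain ⟨f, hf, hbal⟩ := exists_signs_balanced
    (Finset.univ.filter fun e : E(G) ↦ (e : β) ∈ C) D.init D.ter (by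
      intro x
      by_cases hx : x ∈ V(G)
      · have := hC.2 x hx
        rw [D.degreeIn_eq_sum] at this
        exact_mod_cast this
      · rw [Finset.sum_eq_zero]
        · exact Even.zero
        · intro e _
          have h1 : D.init e ≠ x := fun h ↦ hx (h ▸ (D.isLink e).left_mem)
          have h2 : D.ter e ≠ x := fun h ↦ hx (h ▸ (D.isLink e).right_mem)
          simp [h1, h2])
  refine ⟨fun e ↦ if (e : β) ∈ C then f e else 0, fun e ↦ ?_, fun x ↦ ?_⟩
  · by_cases he : (e : β) ∈ C
    · rcases hf e with h | h <;> simp [h, he]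
    · simp [he]
  · refine Eq.trans ?_ (hbal x)
    rw [Finset.sum_filter]
    exact Finset.sum_congr rfl fun e _ ↦ by by_cases he : (e : β) ∈ C <;> simp [he]

/-- A cover by `d + 1` even subgraphs, each edge being covered exactly `k` times, yields an
`𝕊^d`-flow. -/
theorem hasSphereFlow_of_evenSubgraphs (hG : G.IsFinite) {d k : ℕ} (hk : 0 < k)
    (C : Fin (d + 1) → Set β) (hC : ∀ i, G.IsEvenSubgraph (C i))
    (hcov : ∀ e ∈ E(G), {i | e ∈ C i}.ncard = k) : G.HasSphereFlow d := by
  classical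
  have := hG.2.fintype
  obtain ⟨D⟩ := G.nonempty_orientation
  choose f hf hbal using fun i ↦ (hC i).exists_circulation D
  let φ : E(G) → EuclideanSpace ℝ (Fin (d + 1)) := fun e ↦
    WithLp.toLp 2 fun i ↦ (f i e : ℝ) / √k
  have hnorm : ∀ e, ‖φ e‖ = 1 := by
    intro e
    rw [EuclideanSpace.norm_eq, Real.sqrt_eq_one]
    have h1 : ∀ i, ‖φ e i‖ ^ 2 = (if (e : β) ∈ C i then 1 else 0) / k := by
      intro i
      have := hf i e
      simp only [φ, Real.norm_eq_abs, sq_abs, div_pow, Real.sq_sqrt (Nat.cast_nonneg k)]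
      congr 1
      exact_mod_cast this
    have h2 := hcov e e.2
    rw [Set.ncard_eq_toFinset_card', Set.toFinset_ofPred] at h2
    rw [Finset.sum_congr rfl fun i _ ↦ h1 i, ← Finset.sum_div, Finset.sum_boole, h2]
    exact div_self (by positivity)
  refine ⟨D, φ, ⟨D.isCirculation_of_sum_eq_zero φ fun x ↦ ?_, fun e h0 ↦ ?_⟩, fun e ↦ ?_⟩
  · ext i
    have h := congrArg (fun n : ℤ ↦ (n : ℝ) / √k) (hbal i x)
    simp only [Int.cast_sum, Finset.sum_div, Int.cast_zero, zero_div] at h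
    rw [WithLp.ofLp_sum, Finset.sum_apply, PiLp.zero_apply, ← h]
    refine Finset.sum_congr rfl fun e _ ↦ ?_
    simp only [φ, PiLp.smul_apply, zsmul_eq_mul, Int.cast_mul]
    ring
  · have := hnorm e
    rw [h0, norm_zero] at this
    exact zero_ne_one this
  · rw [mem_sphere_zero_iff_norm]
    exact hnorm e

/-- A walk from `x` to `y` avoiding the edge `e` yields a chain with boundary `x + y` that vanishes
at `e`. -/
lemma Orientation.exists_boundaryMap_eq_of_reflTransGen (D : G.Orientation) [Fintype E(G)]
    (e : E(G)) {x y : α} (h : Relation.ReflTransGen (G.deleteEdges {(e : β)}).Adj x y) :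
    ∃ z : E(G) → ZMod 2, z e = 0 ∧
      boundaryMap D.init D.ter z = Finsupp.single x 1 + Finsupp.single y 1 := by
  classical
  induction h with
  | refl => exact ⟨0, rfl, by rw [map_zero, ← Finsupp.single_add, CharTwo.add_self_eq_zero,
      Finsupp.single_zero]⟩
  | @tail b c _ hbc ih =>
    obtain ⟨z, hz, hzb⟩ := ih
    obtain ⟨g, hg⟩ := hbc
    rw [deleteEdges_isLink] at hg
    obtain ⟨hg, hge⟩ := hg
    have hne : e ≠ ⟨g, hg.edge_mem⟩ := by
      rintro rfl
      exact hge rfl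
    refine ⟨z + Pi.single ⟨g, hg.edge_mem⟩ 1, by simp [hz, hne], ?_⟩
    have hb : boundaryMap D.init D.ter (Pi.single ⟨g, hg.edge_mem⟩ 1) =
        Finsupp.single b 1 + Finsupp.single c 1 := by
      rw [boundaryMap, Fintype.linearCombination_apply_single, one_smul]
      rcases (D.isLink ⟨g, hg.edge_mem⟩).eq_and_eq_or_eq_and_eq hg with ⟨h1, h2⟩ | ⟨h1, h2⟩
      · rw [h1, h2]
      · rw [h1, h2, add_comm]
    have hbb : (Finsupp.single b 1 + Finsupp.single b 1 : α →₀ ZMod 2) = 0 := by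
      rw [← Finsupp.single_add, CharTwo.add_self_eq_zero, Finsupp.single_zero]
    rw [map_add, hzb, hb, add_assoc, ← add_assoc (Finsupp.single b 1), hbb, zero_add]

/-- In a bridgeless graph each edge lies in an even subgraph. -/
lemma Bridgeless.exists_cycle_apply_ne_zero (hG : G.Bridgeless) (D : G.Orientation)
    [Fintype E(G)] (e : E(G)) :
    ∃ z : E(G) → ZMod 2, boundaryMap D.init D.ter z = 0 ∧ z e ≠ 0 := by
  classical
  have h : Relation.ReflTransGen (G.deleteEdges {(e : β)}).Adj (D.init e) (D.ter e) := by
    by_contra h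
    exact hG e e.2 ⟨_, _, D.isLink e, h⟩
  obtain ⟨z, hz, hzb⟩ := D.exists_boundaryMap_eq_of_reflTransGen e h
  -- The edge `e` closes up the chain that avoids it.
  refine ⟨z + Pi.single e 1, ?_, by simp [hz]⟩
  rw [map_add, hzb, boundaryMap, Fintype.linearCombination_apply_single, one_smul,
    ← two_smul (ZMod 2), show (2 : ZMod 2) = 0 from rfl, zero_smul]

/-- The support of a vector in the cycle space is an even subgraph. -/
lemma Orientation.isEvenSubgraph_of_boundaryMap_eq_zero (D : G.Orientation) [Fintype E(G)]
    {z : E(G) → ZMod 2} (hz : boundaryMap D.init D.ter z = 0) :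
    G.IsEvenSubgraph (Subtype.val '' {e | z e ≠ 0}) := by
  classical
  refine ⟨fun _ ⟨e, _, he⟩ ↦ he ▸ e.2, fun x _ ↦ ?_⟩
  have h := linearCombination_boundaryMap D.init D.ter (fun v ↦ if v = x then 1 else 0) z
  rw [hz, map_zero] at h
  rw [D.degreeIn_eq_sum, ← ZMod.natCast_eq_zero_iff_even]
  push_cast
  refine Eq.trans ?_ h.symm
  rw [Finset.sum_filter]
  refine Finset.sum_congr rfl fun e _ ↦ ?_
  by_cases he : z e = 0
  · simp [he]
  · simp [ZMod.eq_one_of_ne_zero_two he]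

/-- A bridgeless graph has seven even subgraphs such that each edge lies in exactly four of them. -/
theorem Bridgeless.exists_seven_evenSubgraphs (hG : G.Bridgeless) (hfin : G.IsFinite) :
    ∃ C : Fin 7 → Set β, (∀ i, G.IsEvenSubgraph (C i)) ∧
      ∀ e ∈ E(G), {i | e ∈ C i}.ncard = 4 := by
  classical
  have := hfin.2.fintype
  obtain ⟨D⟩ := G.nonempty_orientation
  obtain ⟨z, hz, hcov⟩ := exists_three_cycles_cover D.init D.ter
    (hG.exists_cycle_apply_ne_zero D)
  -- These are the nonzero vectors of `(ZMod 2)^3`. A nonzero `y` is orthogonal to half of all eight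
  -- vectors, so exactly four rows detect it.
  let σ : Fin 7 → Fin 3 → ZMod 2 := ![![0, 0, 1], ![0, 1, 0], ![0, 1, 1], ![1, 0, 0], ![1, 0, 1],
    ![1, 1, 0], ![1, 1, 1]]
  have hσ : ∀ y : Fin 3 → ZMod 2, (∃ j, y j ≠ 0) →
      (Finset.univ.filter fun i ↦ ∑ j, σ i j * y j ≠ 0).card = 4 := by
    decide
  refine ⟨fun i ↦ Subtype.val '' {e | (∑ j, σ i j • z j) e ≠ 0}, fun i ↦
    D.isEvenSubgraph_of_boundaryMap_eq_zero (by simp [hz]), fun e he ↦ ?_⟩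
  have := hσ (fun j ↦ z j ⟨e, he⟩) (hcov ⟨e, he⟩)
  rw [← this, ← Set.ncard_coe_finset]
  congr 1
  ext i
  simp [he]

/-- The complement of a perfect matching in a cubic graph is an even subgraph. -/
lemma IsPerfectMatching.isEvenSubgraph_sdiff (hfin : G.IsFinite) (hG : G.Cubic) {M : Set β}
    (hM : G.IsPerfectMatching M) : G.IsEvenSubgraph (E(G) \ M) := by
  classical
  have := hfin.2.fintype
  obtain ⟨D⟩ := G.nonempty_orientation
  refine ⟨Set.sdiff_subset, fun x hx ↦ ?_⟩
  have h3 := hG x hx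
  have h1 := hM.2 x hx
  have : G.degreeIn M x + G.degreeIn (E(G) \ M) x = G.degreeIn E(G) x := by
    simp only [D.degreeIn_eq_sum, Set.mem_sdiff, Subtype.coe_prop, true_and, Finset.filter_true]
    exact Finset.sum_filter_add_sum_filter_not _ _ _
  exact ⟨1, by omega⟩

end Graph

theorem mainTheorem9 :
    (∀ (α : Type u) (β : Type v) (G : Graph α β), G.IsFinite → G.Bridgeless →
      G.HasSphereFlow 6) ∧
    (Graph.BergeFulkersonConjecture.{u, v} →
      ∀ (α : Type u) (β : Type v) (G : Graph α β), G.IsFinite → G.Bridgeless → G.Cubic →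
        G.HasSphereFlow 5) ∧
    (Graph.CelminsPreissmannConjecture.{u, v} →
      ∀ (α : Type u) (β : Type v) (G : Graph α β), G.IsFinite → G.Bridgeless →
        G.HasSphereFlow 4) := by
  refine ⟨fun α β G hfin hG ↦ ?_, fun hBF α β G hfin hG hcub ↦ ?_, fun hCP α β G hfin hG ↦ ?_⟩
  · obtain ⟨C, hC, hcov⟩ := hG.exists_seven_evenSubgraphs hfin
    exact Graph.hasSphereFlow_of_evenSubgraphs hfin (by norm_num) C hC hcov
  · obtain ⟨M, hM, hcov⟩ := hBF α β G hfin hG hcub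
    -- Each edge lies in two of the six matchings, hence in `6 - 2 = 4` complements.
    refine Graph.hasSphereFlow_of_evenSubgraphs hfin (k := 4) (by norm_num) (fun i ↦ E(G) \ M i)
      (fun i ↦ (hM i).isEvenSubgraph_sdiff hfin hcub) fun e he ↦ ?_
    have h1 : {i | e ∈ E(G) \ M i} = {i | e ∈ M i}ᶜ := by
      ext; simp [he]
    have h2 := Set.ncard_add_ncard_compl {i | e ∈ M i}
    rw [hcov e he, Nat.card_fin] at h2
    rw [h1]
    omega
  · obtain ⟨C, hC, hcov⟩ := hCP α β G hfin hG
    exact Graph.hasSphereFlow_of_evenSubgraphs hfin (by norm_num) C hC hcov
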